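/- Let $M$ be a smooth manifold (Hausdorff, second countable, without boundary), let $\mathcal D\subset TM$ be a smooth bracket generating subbundle, and let $\langle\,,\rangle$ be a smooth fibrewise inner product on $\mathcal D$ with norm $\|\cdot\|$. A continuous curve $\gamma:[a,b]\to M$ is called absolutely continuous if $\varphi\circ\gamma$ is absolutely continuous for every smooth compactly supported $\varphi:M\to\mathbb R$; it is called horizontal if moreover $\dot\gamma(t)\in\mathcal D$ for a.e. $t\in[a,b]$. Let $\mathcal W_{\mathcal D}([a,b])$ be the set of horizontal absolutely continuous curves $[a,b]\to M$, and let $d(x,y)\in[0,\infty]$ be the Carnot--Carath\'eodory distance, i.e. the infimum of the lengths $\int\|\dot\eta(t)\|\,dt$ over all horizontal absolutely continuous curves $\eta$ from $x$ to $y$ (with $d(x,y)=\infty$ if there are none). Let $(\gamma_n)_n$ be a sequence in $\mathcal W_{\mathcal D}([a,b])$ and let $\gamma:[a,b]\to M$ be a map such that $\sup_{t\in[a,b]}d(\gamma_n(t),\gamma(t))\to0$. Suppose that the functions $\|\dot\gamma_n\|$ are uniformly integrable, i.e. they lie in $L^1([a,b])$ and for every $\varepsilon>0$ there is $\delta>0$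 such that $\int_E\|\dot\gamma_n(t)\|\,dt<\varepsilon$ for all $n$ and all measurable $E\subset[a,b]$ of Lebesgue measure less than $\delta$. Then $\gamma\in\mathcal W_{\mathcal D}([a,b])$. -/

import Mathlib

open Set MeasureTheory
open scoped Manifold ContDiff

noncomputable section

/-- A vector field on `M` which is smooth on the set `U`. -/
def SmoothFieldOn {n : ℕ} {M : Type*} [TopologicalSpace M]
    [ChartedSpace (EuclideanSpace ℝ (Fin n)) M] [IsManifold (𝓡 n) ∞ M]
    (X : ∀ x : M, TangentSpace (𝓡 n) x) (U : Set M) : Prop :=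
  ContMDiffOn (𝓡 n) (𝓡 n).tangent ∞ (fun x => (⟨x, X x⟩ : TangentBundle (𝓡 n) M)) U

/-- A sub-Riemannian structure on the smooth manifold `M`: a smooth subbundle `D` of the tangent
bundle together with a smooth fibrewise inner product on `D`. -/
structure SubRiemannianStructure (n : ℕ) (M : Type*) [TopologicalSpace M]
    [ChartedSpace (EuclideanSpace ℝ (Fin n)) M] [IsManifold (𝓡 n) ∞ M] where
  /-- the fibres of the horizontal distribution -/
  D : ∀ x : M, Submodule ℝ (TangentSpace (𝓡 n) x)
  /-- near every point, `D` has a smooth frame -/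
  exists_frame : ∀ x₀ : M, ∃ U : Set M, IsOpen U ∧ x₀ ∈ U ∧ ∃ (k : ℕ) (X : Fin k → ∀ x : M, D x),
    (∀ i, SmoothFieldOn (fun x => (X i x : TangentSpace (𝓡 n) x)) U) ∧
    ∀ x ∈ U, LinearIndependent ℝ (fun i => X i x) ∧
      Submodule.span ℝ (range fun i => X i x) = ⊤
  /-- the inner product on the fibres of `D` -/
  inner : ∀ x : M, D x →ₗ[ℝ] D x →ₗ[ℝ] ℝ
  inner_symm : ∀ (x : M) (v w : D x), inner x v w = inner x w v
  inner_pos : ∀ (x : M) (v : D x), v ≠ 0 → 0 < inner x v v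
  /-- the inner product of two smooth local sections of `D` is a smooth function -/
  inner_smooth : ∀ U : Set M, IsOpen U → ∀ X Y : ∀ x : M, D x,
    SmoothFieldOn (fun x => (X x : TangentSpace (𝓡 n) x)) U →
    SmoothFieldOn (fun x => (Y x : TangentSpace (𝓡 n) x)) U →
    ContMDiffOn (𝓡 n) 𝓘(ℝ, ℝ) ∞ (fun x => inner x (X x) (Y x)) U

/-- The velocity of a curve at time `t` (zero where the curve is not differentiable). -/
def velocity {n : ℕ} {M : Type*} [TopologicalSpace M]
    [ChartedSpace (EuclideanSpace ℝ (Fin n)) M]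
    (γ : ℝ → M) (t : ℝ) : TangentSpace (𝓡 n) (γ t) :=
  mfderiv 𝓘(ℝ, ℝ) (𝓡 n) γ t (1 : ℝ)

/-- A curve is absolutely continuous on `[a, b]` if it is continuous there and its composition
with each smooth compactly supported real function is absolutely continuous on `[a, b]`. -/
def IsACCurve {n : ℕ} {M : Type*} [TopologicalSpace M]
    [ChartedSpace (EuclideanSpace ℝ (Fin n)) M] (γ : ℝ → M) (a b : ℝ) : Prop :=
  ContinuousOn γ (Icc a b) ∧
  ∀ φ : M → ℝ, ContMDiff (𝓡 n) 𝓘(ℝ, ℝ) ∞ φ → HasCompactSupport φ →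
    AbsolutelyContinuousOnInterval (φ ∘ γ) a b

namespace SubRiemannianStructure

variable {n : ℕ} {M : Type*} [TopologicalSpace M]
    [ChartedSpace (EuclideanSpace ℝ (Fin n)) M] [IsManifold (𝓡 n) ∞ M]

/-- The vector fields obtained from the smooth global sections of `D` by iterated Lie brackets. -/
inductive IsIteratedBracket (S : SubRiemannianStructure n M) :
    (∀ x : M, TangentSpace (𝓡 n) x) → Prop
  | base (X : ∀ x : M, TangentSpace (𝓡 n) x) (hX : SmoothFieldOn X univ)
      (hD : ∀ x, X x ∈ S.D x) : IsIteratedBracket S X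
  | bracket (X Y : ∀ x : M, TangentSpace (𝓡 n) x) (hX : IsIteratedBracket S X)
      (hY : IsIteratedBracket S Y) :
      IsIteratedBracket S (VectorField.mlieBracket (𝓡 n) X Y)

/-- `D` is bracket generating: the iterated brackets span every tangent space. -/
def BracketGenerating (S : SubRiemannianStructure n M) : Prop :=
  ∀ x : M, Submodule.span ℝ {v : TangentSpace (𝓡 n) x | ∃ X, S.IsIteratedBracket X ∧ X x = v} = ⊤

/-- The curve `γ`, restricted to `[a, b]`, is horizontal absolutely continuous. -/
def IsHorizontal (S : SubRiemannianStructure n M) (γ : ℝ → M) (a b : ℝ) : Prop :=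
  IsACCurve (n := n) γ a b ∧
  ∀ᵐ t ∂(volume.restrict (Icc a b)),
    MDifferentiableAt 𝓘(ℝ, ℝ) (𝓡 n) γ t ∧ velocity (n := n) γ t ∈ S.D (γ t)

open Classical in
/-- The norm `‖v‖ = √⟨v, v⟩` of a horizontal vector (with the irrelevant value `0` for a vector
which is not horizontal). -/
def norm (S : SubRiemannianStructure n M) {x : M} (v : TangentSpace (𝓡 n) x) : ℝ :=
  if h : v ∈ S.D x then Real.sqrt (S.inner x ⟨v, h⟩ ⟨v, h⟩) else 0

/-- The speed `‖γ̇(t)‖`. -/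
def speed (S : SubRiemannianStructure n M) (γ : ℝ → M) (t : ℝ) : ℝ :=
  S.norm (velocity (n := n) γ t)

/-- The sub-Riemannian length `∫ ‖γ̇(t)‖ dt` over `[a, b]`. -/
def length (S : SubRiemannianStructure n M) (γ : ℝ → M) (a b : ℝ) : ENNReal :=
  ∫⁻ t in Icc a b, ENNReal.ofReal (S.speed γ t)

/-- The Carnot-Carathéodory distance: the infimum of the lengths of the horizontal absolutely
continuous curves from `x` to `y` (`⊤` if there is no such curve). -/
def ccDist (S : SubRiemannianStructure n M) (x y : M) : ENNReal :=
  sInf {l | ∃ (a b : ℝ) (γ : ℝ → M), a ≤ b ∧ S.IsHorizontal γ a b ∧ γ a = x ∧ γ b = y ∧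
    l = S.length γ a b}

/-- The curves `γs k` converge to `γ` uniformly on `[a, b]` for the Carnot-Carathéodory
distance. -/
def CCTendstoUniformlyOn (S : SubRiemannianStructure n M) (γs : ℕ → ℝ → M) (γ : ℝ → M)
    (a b : ℝ) : Prop :=
  ∀ ε : ENNReal, 0 < ε → ∃ N : ℕ, ∀ k ≥ N, ∀ t ∈ Icc a b, S.ccDist (γs k t) (γ t) < ε

end SubRiemannianStructure

/-- Uniform integrability on `[a, b]` of a sequence of integrable functions. -/
def UniformlyIntegrableOn (f : ℕ → ℝ → ℝ) (a b : ℝ) : Prop :=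
  (∀ k, IntegrableOn (f k) (Icc a b)) ∧
  ∀ ε : ℝ, 0 < ε → ∃ δ : ℝ, 0 < δ ∧ ∀ (k : ℕ) (E : Set ℝ), E ⊆ Icc a b → MeasurableSet E →
    volume E < ENNReal.ofReal δ → ∫ t in E, |f k t| < ε

end

open Filter Topology
set_option linter.unusedSectionVars false

/-! Everything is tested on smooth compactly supported `φ`. A local frame and compactness give
`|dφ(v)| ≤ C ‖v‖` on `D`, so `φ` is Lipschitz for `ccDist` and `φ ∘ γs k → φ ∘ γ` uniformly. The
increments of `φ ∘ γs k` are bounded by `C` times integrals of the speeds, and uniform integrability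
passes to the limit as absolute continuity (`CCTendstoUniformlyOn.isACCurve`). For horizontality,
the primitives of the speeds converge along an ultrafilter to a monotone `F`, differentiable a.e. At
a time `t` where `γ` and `F` are differentiable, suppose the velocity is not in `D`. Some `φ` then
has `dφ = 0` on the fibre at `γ t` but not on the velocity. Near `γ t` one has `|dφ| ≤ ε ‖·‖` on
`D`, so the increments of `φ ∘ γ` at `t` are `o(F s - F t) = o(s - t)`
(`CCTendstoUniformlyOn.isLittleO`): `dφ` kills the velocity, a contradiction. No weak limit of the
velocities is needed. -/

section SubRiemannian

variable {n : ℕ} {M : Type*} [TopologicalSpace M]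
    [ChartedSpace (EuclideanSpace ℝ (Fin n)) M] [IsManifold (𝓡 n) ∞ M]

/-! ### Differentials and cut-off coordinates -/

/-- The differential of a real function at a point, as a linear functional. -/
noncomputable def differential (φ : M → ℝ) (x : M) : TangentSpace (𝓡 n) x →ₗ[ℝ] ℝ :=
  (mfderiv (𝓡 n) 𝓘(ℝ, ℝ) φ x).toLinearMap

/-- The derivative of a smooth function along a smooth vector field is continuous. -/
theorem SmoothFieldOn.continuousOn_differential {X : ∀ x : M, TangentSpace (𝓡 n) x} {U : Set M}
    (hX : SmoothFieldOn X U) {φ : M → ℝ} (hφ : ContMDiff (𝓡 n) 𝓘(ℝ, ℝ) ∞ φ) :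
    ContinuousOn (fun x => differential φ x (X x)) U := by
  have h1 : Continuous (tangentMap (𝓡 n) 𝓘(ℝ, ℝ) φ) :=
    hφ.continuous_tangentMap (by simp)
  have h2 := (contMDiff_snd_tangentBundle_modelSpace (n := ∞) ℝ 𝓘(ℝ, ℝ)).continuous
  exact (h2.comp h1).comp_continuousOn (ContMDiffOn.continuousOn hX)

/-- The function `f ∘ extChartAt p`, cut off by a bump function which is equal to `1` near `p`. -/
noncomputable def cutoffCoord (p : M) (f : EuclideanSpace ℝ (Fin n) → ℝ) (x : M) : ℝ :=
  (Classical.arbitrary (SmoothBumpFunction (𝓡 n) p)) x * f (extChartAt (𝓡 n) p x)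

theorem contMDiff_cutoffCoord [T2Space M] (p : M) {f : EuclideanSpace ℝ (Fin n) → ℝ}
    (hf : ContDiff ℝ ∞ f) : ContMDiff (𝓡 n) 𝓘(ℝ, ℝ) ∞ (cutoffCoord p f : M → ℝ) := by
  refine (Classical.arbitrary (SmoothBumpFunction (𝓡 n) p)).contMDiff_smul
    (g := fun x => f (extChartAt (𝓡 n) p x)) ?_
  exact hf.contMDiff.comp_contMDiffOn contMDiffOn_extChartAt

theorem hasCompactSupport_cutoffCoord [T2Space M] (p : M) (f : EuclideanSpace ℝ (Fin n) → ℝ) :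
    HasCompactSupport (cutoffCoord p f : M → ℝ) :=
  (Classical.arbitrary (SmoothBumpFunction (𝓡 n) p)).hasCompactSupport.mul_right

theorem eventually_cutoffCoord_eq (p : M) :
    ∀ᶠ x : M in 𝓝 p, ∀ f : EuclideanSpace ℝ (Fin n) → ℝ,
      cutoffCoord p f x = f (extChartAt (𝓡 n) p x) := by
  filter_upwards [(Classical.arbitrary (SmoothBumpFunction (𝓡 n) p)).eventuallyEq_one] with x hx f
  simp [cutoffCoord, hx]

theorem MDifferentiableAt.hasDerivAt_comp {γ : ℝ → M} {t : ℝ}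
    (hγ : MDifferentiableAt 𝓘(ℝ, ℝ) (𝓡 n) γ t) {φ : M → ℝ}
    (hφ : MDifferentiableAt (𝓡 n) 𝓘(ℝ, ℝ) φ (γ t)) :
    HasDerivAt (φ ∘ γ) (differential φ (γ t) (velocity (n := n) γ t)) t := by
  have h := (hφ.comp t hγ).differentiableAt.hasDerivAt
  rw [← fderiv_apply_one_eq_deriv, ← mfderiv_eq_fderiv, mfderiv_comp t hφ hγ] at h
  exact h

/-! ### Bounds for differentials on horizontal vectors -/

namespace SubRiemannianStructure

variable (S : SubRiemannianStructure n M)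

theorem zero_le_norm {x : M}
    (v : TangentSpace (𝓡 n) x) : 0 ≤ S.norm v := by
  unfold norm; split_ifs <;> positivity

theorem norm_coe {x : M} (v : S.D x) :
    S.norm (v : TangentSpace (𝓡 n) x) = Real.sqrt (S.inner x v v) := by
  simp [norm]

theorem inner_self_sum {k : ℕ} {x : M} (X : Fin k → S.D x) (c : Fin k → ℝ) :
    S.inner x (∑ i, c i • X i) (∑ i, c i • X i)
      = ∑ i, ∑ j, c i * c j * S.inner x (X i) (X j) := by
  simp only [map_sum, map_smul, LinearMap.sum_apply, LinearMap.smul_apply, smul_eq_mul,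
    Finset.mul_sum]
  rw [Finset.sum_comm]
  refine Finset.sum_congr rfl fun i _ => Finset.sum_congr rfl fun j _ => by ring

/-- Near every point, the components of a horizontal vector in a smooth frame are bounded by a
multiple of its norm. -/
theorem exists_frame_bound (x₀ : M) :
    ∃ U : Set M, IsOpen U ∧ x₀ ∈ U ∧ ∃ (k : ℕ) (X : Fin k → ∀ x : M, S.D x),
      (∀ i, SmoothFieldOn (fun x => (X i x : TangentSpace (𝓡 n) x)) U) ∧
      ∃ K : ℝ, 0 < K ∧ ∀ x ∈ U, ∀ v : S.D x, ∃ c : Fin k → ℝ, v = ∑ i, c i • X i x ∧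
        ∀ i, |c i| ≤ K * S.norm (v : TangentSpace (𝓡 n) x) := by
  obtain ⟨U, hU, hx₀, k, X, hX, hfr⟩ := S.exists_frame x₀
  -- The squared norm in frame coordinates, jointly continuous in point and coefficients. A positive
  -- lower bound `m` on the unit sphere at `x₀` persists nearby by compactness; homogeneity then
  -- gives the constant `1 / √m`.
  set Q : M × (Fin k → ℝ) → ℝ := fun p =>
    ∑ i, ∑ j, p.2 i * p.2 j * S.inner p.1 (X i p.1) (X j p.1) with hQ
  have hQeq : ∀ x (c : Fin k → ℝ), S.inner x (∑ i, c i • X i x) (∑ i, c i • X i x) = Q (x, c) :=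
    fun x c => S.inner_self_sum _ _
  have hQc : ContinuousOn Q (U ×ˢ univ) := by
    refine continuousOn_finsetSum _ fun i _ => continuousOn_finsetSum _ fun j _ => ?_
    refine ContinuousOn.mul (by fun_prop) ?_
    exact (S.inner_smooth U hU (X i) (X j) (hX i) (hX j)).continuousOn.comp continuousOn_fst
      fun p hp => hp.1
  have hcpt : IsCompact (Metric.sphere (0 : Fin k → ℝ) 1) := isCompact_sphere _ _
  have hpos : ∀ c ∈ Metric.sphere (0 : Fin k → ℝ) 1, 0 < Q (x₀, c) := by
    intro c hc
    rw [← hQeq]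
    refine S.inner_pos _ _ fun h0 => ?_
    have := (Fintype.linearIndependent_iff.1 (hfr x₀ hx₀).1) c h0
    have hc0 : c = 0 := funext this
    simp [hc0] at hc
  obtain ⟨m, hm, hmQ⟩ : ∃ m : ℝ, 0 < m ∧ ∀ c ∈ Metric.sphere (0 : Fin k → ℝ) 1, m < Q (x₀, c) := by
    -- The sphere is empty when `D` has rank `0`.
    rcases (Metric.sphere (0 : Fin k → ℝ) 1).eq_empty_or_nonempty with he | hne
    · exact ⟨1, one_pos, by simp [he]⟩
    · have hcont : ContinuousOn (fun c => Q (x₀, c)) (Metric.sphere (0 : Fin k → ℝ) 1) :=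
        hQc.comp (by fun_prop) fun c _ => ⟨hx₀, mem_univ _⟩
      obtain ⟨c₀, hc₀, hmin⟩ := hcpt.exists_isMinOn hne hcont
      refine ⟨Q (x₀, c₀) / 2, half_pos (hpos _ hc₀), fun c hc => ?_⟩
      have := hmin hc
      have h2 := hpos _ hc₀
      simp only [mem_ofPred_eq] at this
      linarith
  have hev : ∀ᶠ x in 𝓝 x₀, ∀ c ∈ Metric.sphere (0 : Fin k → ℝ) 1, m < Q (x, c) := by
    refine hcpt.eventually_forall_of_forall_eventually fun c hc => ?_
    have : ContinuousAt Q (x₀, c) := hQc.continuousAt ((hU.prod isOpen_univ).mem_nhds ⟨hx₀, mem_univ _⟩)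
    exact this.eventually (lt_mem_nhds (hmQ c hc))
  obtain ⟨V, hVm, hV, hxV⟩ := eventually_nhds_iff.1 hev
  refine ⟨U ∩ V, hU.inter hV, ⟨hx₀, hxV⟩, k, X, fun i => (hX i).mono inter_subset_left,
    (Real.sqrt m)⁻¹, by positivity, fun x hx v => ?_⟩
  have hv : v ∈ Submodule.span ℝ (range fun i => X i x) := by
    rw [(hfr x hx.1).2]; trivial
  obtain ⟨c, hc⟩ := (Submodule.mem_span_range_iff_exists_fun ℝ).1 hv
  refine ⟨c, hc.symm, fun i => ?_⟩
  have hci : |c i| ≤ ‖c‖ := norm_le_pi_norm c i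
  refine hci.trans ?_
  rw [S.norm_coe, ← hc, hQeq]
  rw [inv_mul_eq_div, le_div_iff₀ (by positivity)]
  refine Real.le_sqrt_of_sq_le ?_
  rw [mul_pow, Real.sq_sqrt hm.le]
  rcases eq_or_ne c 0 with h0 | h0
  · simp [h0, hQ]
  · have hn : ‖c‖ ≠ 0 := norm_ne_zero_iff.2 h0
    have h1 := hVm x hx.2 (‖c‖⁻¹ • c) (by simp [norm_smul, hn])
    have h2 : Q (x, c) = ‖c‖ ^ 2 * Q (x, ‖c‖⁻¹ • c) := by
      simp only [hQ, Finset.mul_sum, Pi.smul_apply, smul_eq_mul]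
      refine Finset.sum_congr rfl fun i _ => Finset.sum_congr rfl fun j _ => by field_simp
    rw [h2]
    gcongr

/-- Common source of the global bound (`g` is locally bounded) and of the `ε`-bound near a point
where `dφ` annihilates `D` (`g` is small there). -/
theorem exists_continuousAt_abs_differential_le {φ : M → ℝ}
    (hφ : ContMDiff (𝓡 n) 𝓘(ℝ, ℝ) ∞ φ) (x₀ : M) :
    ∃ g : M → ℝ, ContinuousAt g x₀ ∧ ((∀ v ∈ S.D x₀, differential φ x₀ v = 0) → g x₀ = 0) ∧
      ∀ᶠ x in 𝓝 x₀, ∀ v ∈ S.D x, |differential φ x v| ≤ g x * S.norm v := by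
  obtain ⟨U, hU, hx₀, k, X, hX, K, hK, hb⟩ := S.exists_frame_bound x₀
  refine ⟨fun x => K * ∑ i, |differential (n := n) φ x (X i x)|, ?_, fun h => ?_, ?_⟩
  · refine ContinuousOn.continuousAt (continuousOn_const.mul ?_) (hU.mem_nhds hx₀)
    exact continuousOn_finsetSum _ fun i _ => ((hX i).continuousOn_differential hφ).abs
  · simp [fun i => h (X i x₀) (X i x₀).2]
  · filter_upwards [hU.mem_nhds hx₀] with x hx v hv
    obtain ⟨c, hc, hcK⟩ := hb x hx ⟨v, hv⟩
    have hv' : v = ∑ i, c i • (X i x : TangentSpace (𝓡 n) x) := by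
      have := congrArg Subtype.val hc
      simpa using this
    calc |differential φ x v| = |∑ i, c i * differential (n := n) φ x (X i x)| := by
          conv_lhs => rw [hv']
          simp [map_sum]
      _ ≤ ∑ i, |c i * differential (n := n) φ x (X i x)| := Finset.abs_sum_le_sum_abs _ _
      _ ≤ ∑ i, K * S.norm v * |differential (n := n) φ x (X i x)| := by
          refine Finset.sum_le_sum fun i _ => ?_
          rw [abs_mul]
          exact mul_le_mul_of_nonneg_right (hcK i) (abs_nonneg _)
      _ = _ := by rw [← Finset.mul_sum]; ring

/-- The differential of a smooth compactly supported function is bounded on horizontal vectors. -/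
theorem exists_abs_differential_le {φ : M → ℝ} (hφ : ContMDiff (𝓡 n) 𝓘(ℝ, ℝ) ∞ φ)
    (hc : HasCompactSupport φ) :
    ∃ C : ℝ, 0 < C ∧ ∀ x, ∀ v ∈ S.D x, |differential φ x v| ≤ C * S.norm v := by
  have hloc : ∀ x₀ : M, ∃ C : ℝ, ∀ᶠ x in 𝓝 x₀, ∀ v ∈ S.D x,
      |differential φ x v| ≤ C * S.norm v := by
    intro x₀
    obtain ⟨g, hg, -, hb⟩ := S.exists_continuousAt_abs_differential_le hφ x₀
    refine ⟨g x₀ + 1, ?_⟩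
    filter_upwards [hb, hg.eventually (gt_mem_nhds (lt_add_one (g x₀)))] with x h1 h2 v hv
    exact (h1 v hv).trans (mul_le_mul_of_nonneg_right h2.le (S.zero_le_norm v))
  choose C hC using hloc
  obtain ⟨s, -, hs⟩ := hc.isCompact.elim_nhds_subcover _ fun x _ => hC x
  refine ⟨∑ x ∈ s, |C x| + 1, by positivity, fun x v hv => ?_⟩
  by_cases hx : x ∈ tsupport φ
  · obtain ⟨y, hy, hxy⟩ := mem_iUnion₂.1 (hs hx)
    refine (hxy v hv).trans (mul_le_mul_of_nonneg_right ?_ (S.zero_le_norm v))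
    have := Finset.single_le_sum (f := fun x => |C x|) (fun i _ => abs_nonneg _) hy
    have h2 := le_abs_self (C y)
    linarith
  · have h0 : φ =ᶠ[𝓝 x] fun _ => 0 := notMem_tsupport_iff_eventuallyEq.1 hx
    have : differential (n := n) φ x = 0 := by
      rw [differential, h0.mfderiv_eq, mfderiv_const]; rfl
    rw [this]
    have := S.zero_le_norm v
    simp only [LinearMap.zero_apply, abs_zero]
    positivity

theorem eventually_abs_differential_le {φ : M → ℝ} (hφ : ContMDiff (𝓡 n) 𝓘(ℝ, ℝ) ∞ φ) {x₀ : M}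
    (h : ∀ v ∈ S.D x₀, differential φ x₀ v = 0) {ε : ℝ} (hε : 0 < ε) :
    ∀ᶠ x in 𝓝 x₀, ∀ v ∈ S.D x, |differential φ x v| ≤ ε * S.norm v := by
  obtain ⟨g, hg, h0, hb⟩ := S.exists_continuousAt_abs_differential_le hφ x₀
  have : g x₀ < ε := by rwa [h0 h]
  filter_upwards [hb, hg.eventually (gt_mem_nhds this)] with x h1 h2 v hv
  exact (h1 v hv).trans (mul_le_mul_of_nonneg_right h2.le (S.zero_le_norm v))

/-! ### Increments along horizontal curves and uniform convergence -/

variable {S}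

theorem IsHorizontal.mono {η : ℝ → M} {a b s t : ℝ} (h : S.IsHorizontal η a b)
    (hs : a ≤ s) (hst : s ≤ t) (ht : t ≤ b) : S.IsHorizontal η s t := by
  have hsub : Icc s t ⊆ Icc a b := Icc_subset_Icc hs ht
  refine ⟨⟨h.1.1.mono hsub, fun φ h1 h2 => (h.1.2 φ h1 h2).mono ?_⟩,
    ae_mono (Measure.restrict_mono hsub le_rfl) h.2⟩
  rwa [uIcc_of_le hst, uIcc_of_le (hs.trans (hst.trans ht))]

/-- Fundamental theorem of calculus for `φ ∘ η`. The bound on `dφ` is required only along the curve,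
so that it can be applied locally. -/
theorem IsHorizontal.abs_sub_le {η : ℝ → M} {s t : ℝ} (h : S.IsHorizontal η s t) (hst : s ≤ t)
    {φ : M → ℝ} (hφ : ContMDiff (𝓡 n) 𝓘(ℝ, ℝ) ∞ φ) (hc : HasCompactSupport φ) {C : ℝ} (hC : 0 ≤ C)
    (hle : ∀ τ ∈ Icc s t, ∀ v ∈ S.D (η τ), |differential φ (η τ) v| ≤ C * S.norm v) :
    ENNReal.ofReal |φ (η t) - φ (η s)| ≤ ENNReal.ofReal C * S.length η s t := by
  have hac := h.1.2 φ hφ hc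
  have hint := hac.integral_deriv_eq_sub
  simp only [Function.comp_apply] at hint
  rw [← hint, intervalIntegral.integral_of_le hst, ← Real.norm_eq_abs, ofReal_norm]
  refine (enorm_integral_le_lintegral_enorm _).trans ?_
  rw [length, ← lintegral_const_mul' _ _ ENNReal.ofReal_ne_top]
  refine (lintegral_mono_set Ioc_subset_Icc_self).trans (lintegral_mono_ae ?_)
  filter_upwards [h.2, ae_restrict_mem measurableSet_Icc] with τ h1 hτ
  rw [(h1.1.hasDerivAt_comp (hφ.mdifferentiable (by simp) _)).deriv, ← ofReal_norm,
    ← ENNReal.ofReal_mul hC]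
  exact ENNReal.ofReal_le_ofReal (hle τ hτ _ h1.2)

theorem abs_sub_le_ccDist {φ : M → ℝ} (hφ : ContMDiff (𝓡 n) 𝓘(ℝ, ℝ) ∞ φ)
    (hc : HasCompactSupport φ) {C : ℝ} (hC : 0 < C)
    (hle : ∀ x, ∀ v ∈ S.D x, |differential φ x v| ≤ C * S.norm v) (x y : M) :
    ENNReal.ofReal |φ y - φ x| ≤ ENNReal.ofReal C * S.ccDist x y := by
  have hC' : ENNReal.ofReal C ≠ 0 := by simpa using hC
  rw [ccDist, mul_comm, ← ENNReal.div_le_iff hC' ENNReal.ofReal_ne_top]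
  refine le_sInf ?_
  rintro _ ⟨s, t, η, hst, hη, rfl, rfl, rfl⟩
  rw [ENNReal.div_le_iff hC' ENNReal.ofReal_ne_top, mul_comm]
  exact hη.abs_sub_le hst hφ hc hC.le fun τ _ => hle _

theorem CCTendstoUniformlyOn.comp {γs : ℕ → ℝ → M} {γ : ℝ → M} {a b : ℝ}
    (h : S.CCTendstoUniformlyOn γs γ a b) {φ : M → ℝ} (hφ : ContMDiff (𝓡 n) 𝓘(ℝ, ℝ) ∞ φ)
    (hc : HasCompactSupport φ) :
    TendstoUniformlyOn (fun k => φ ∘ γs k) (φ ∘ γ) atTop (Icc a b) := by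
  obtain ⟨C, hC, hle⟩ := S.exists_abs_differential_le hφ hc
  rw [Metric.tendstoUniformlyOn_iff]
  intro ε hε
  obtain ⟨N, hN⟩ := h (ENNReal.ofReal (ε / C)) (by simpa using div_pos hε hC)
  filter_upwards [eventually_ge_atTop N] with k hk t ht
  have h1 := abs_sub_le_ccDist hφ hc hC hle (γs k t) (γ t)
  have h2 : ENNReal.ofReal C * S.ccDist (γs k t) (γ t)
      < ENNReal.ofReal C * ENNReal.ofReal (ε / C) :=
    ENNReal.mul_lt_mul_right (by simpa using hC) ENNReal.ofReal_ne_top (hN k hk t ht)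
  rw [← ENNReal.ofReal_mul hC.le, mul_div_cancel₀ _ hC.ne'] at h2
  exact (ENNReal.ofReal_lt_ofReal_iff hε).1 (h1.trans_lt h2)

/-- Supports of bump functions form a neighbourhood basis at `γ t`, and a bump function composed
with `γ` is continuous as a uniform limit. -/
theorem CCTendstoUniformlyOn.continuousOn [T2Space M] {γs : ℕ → ℝ → M} {γ : ℝ → M} {a b : ℝ}
    (h : S.CCTendstoUniformlyOn γs γ a b) (hγs : ∀ k, ContinuousOn (γs k) (Icc a b)) :
    ContinuousOn γ (Icc a b) := by
  intro t ht
  refine ((SmoothBumpFunction.nhds_basis_tsupport (I := 𝓡 n) (γ t)).tendsto_right_iff).2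
    fun f _ => ?_
  have hcont : ContinuousOn (f ∘ γ) (Icc a b) :=
    (h.comp f.contMDiff f.hasCompactSupport).continuousOn
      (Eventually.frequently (Eventually.of_forall fun k => f.continuous.comp_continuousOn (hγs k)))
  have h1 : f (γ t) ≠ 0 := by simp
  filter_upwards [(hcont t ht).eventually_ne h1] with s hs
  exact subset_tsupport _ hs

end SubRiemannianStructure
end SubRiemannian

/-! ### Uniformly integrable sequences on an interval -/

theorem UniformlyIntegrableOn.exists_bound {f : ℕ → ℝ → ℝ} {a b : ℝ}
    (h : UniformlyIntegrableOn f a b) : ∃ B : ℝ, ∀ k, ∫ t in Icc a b, |f k t| ≤ B := by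
  obtain ⟨δ, hδ, H⟩ := h.2 1 one_pos
  have hI : ∀ k, IntegrableOn (fun t => |f k t|) (Icc a b) := fun k => (h.1 k).abs
  -- Each further piece of length `δ / 2 < δ` contributes less than `1`.
  have key : ∀ m : ℕ, ∀ k, ∫ t in Icc a b ∩ Iic (a + m * (δ / 2)), |f k t| ≤ m := by
    intro m k
    induction m with
    | zero =>
      have h0 : volume (Icc a b ∩ Iic (a + (0 : ℕ) * (δ / 2))) = 0 := by
        refine measure_mono_null (t := {a}) (fun x hx => ?_) (by simp)
        have h1 := hx.1.1
        have h2 : x ≤ a := by simpa using hx.2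
        exact le_antisymm h2 h1
      rw [setIntegral_measure_zero _ h0]
      simp
    | succ m ih =>
      have hsplit : Icc a b ∩ Iic (a + (m + 1 : ℕ) * (δ / 2)) =
          (Icc a b ∩ Iic (a + m * (δ / 2))) ∪
            (Icc a b ∩ Ioc (a + m * (δ / 2)) (a + (m + 1 : ℕ) * (δ / 2))) := by
        rw [← inter_union_distrib_left, Iic_union_Ioc_eq_Iic]
        push_cast
        nlinarith
      have hmeas : MeasurableSet (Icc a b ∩ Ioc (a + m * (δ / 2)) (a + (m + 1 : ℕ) * (δ / 2))) :=
        measurableSet_Icc.inter measurableSet_Ioc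
      rw [hsplit, setIntegral_union _ hmeas ((hI k).mono_set inter_subset_left)
        ((hI k).mono_set inter_subset_left)]
      · have := H k _ inter_subset_left hmeas (by
          refine (measure_mono inter_subset_right).trans_lt ?_
          rw [Real.volume_Ioc, ENNReal.ofReal_lt_ofReal_iff hδ]
          push_cast
          linarith)
        push_cast at this ⊢
        linarith
      · refine Disjoint.mono inter_subset_right inter_subset_right ?_
        exact Set.disjoint_left.2 fun x hx hx' => not_lt.2 hx hx'.1
  obtain ⟨m, hm⟩ := exists_nat_ge ((b - a) / (δ / 2))
  refine ⟨m, fun k => ?_⟩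
  have := key m k
  rwa [inter_eq_left.2] at this
  intro x hx
  rw [div_le_iff₀ (by positivity)] at hm
  simp only [mem_Iic]
  linarith [hx.2]

/-- The primitives of a uniformly integrable sequence converge along some ultrafilter to a monotone
function. -/
theorem UniformlyIntegrableOn.exists_monotone {f : ℕ → ℝ → ℝ} {a b : ℝ}
    (h : UniformlyIntegrableOn f a b) :
    ∃ (𝒰 : Ultrafilter ℕ) (F : ℝ → ℝ), (𝒰 : Filter ℕ) ≤ atTop ∧ Monotone F ∧
      ∀ s ∈ Icc a b, ∀ t ∈ Icc a b, s ≤ t →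
        Tendsto (fun k => ∫ τ in Ioc s t, |f k τ|) 𝒰 (𝓝 (F t - F s)) := by
  obtain ⟨B, hB⟩ := h.exists_bound
  have hI : ∀ k, IntegrableOn (fun t => |f k t|) (Icc a b) := fun k => (h.1 k).abs
  set G : ℕ → ℝ → ℝ := fun k t => ∫ τ in Icc a b ∩ Iic t, |f k τ| with hG
  have hGm : ∀ k, Monotone (G k) := fun k s t hst =>
    setIntegral_mono_set ((hI k).mono_set inter_subset_left)
      (Eventually.of_forall fun _ => abs_nonneg _)
      (inter_subset_inter_right _ (Iic_subset_Iic.2 hst)).eventuallyLE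
  have hGB : ∀ k t, G k t ∈ Icc 0 B := fun k t =>
    ⟨integral_nonneg fun _ => abs_nonneg _,
      (setIntegral_mono_set (hI k) (Eventually.of_forall fun _ => abs_nonneg _)
        inter_subset_left.eventuallyLE).trans (hB k)⟩
  -- Compactness of `[0, B]` gives limits at all `t` along one ultrafilter, in place of Helly's
  -- selection theorem.
  have hlim : ∀ t, ∃ y, Tendsto (fun k => G k t) (hyperfilter ℕ) (𝓝 y) := by
    intro t
    obtain ⟨y, -, hy⟩ := (isCompact_Icc (a := (0 : ℝ)) (b := B)).ultrafilter_le_nhds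
      ((hyperfilter ℕ).map fun k => G k t)
      (by simp only [Ultrafilter.coe_map, le_principal_iff]
          exact mem_map.2 (Eventually.of_forall fun k => hGB k t))
    exact ⟨y, hy⟩
  choose F hF using hlim
  refine ⟨hyperfilter ℕ, F, Nat.hyperfilter_le_atTop, fun s t hst =>
    le_of_tendsto_of_tendsto' (hF s) (hF t) fun k => hGm k hst, fun s hs t ht hst => ?_⟩
  refine ((hF t).sub (hF s)).congr fun k => ?_
  have hsplit : Icc a b ∩ Iic t = (Icc a b ∩ Iic s) ∪ Ioc s t := by
    ext x
    simp only [mem_inter_iff, mem_Icc, mem_Iic, mem_union, mem_Ioc]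
    have := hs.1
    have := ht.2
    constructor
    · rintro ⟨h1, h2⟩
      rcases le_or_gt x s with h3 | h3
      · exact Or.inl ⟨h1, h3⟩
      · exact Or.inr ⟨h3, h2⟩
    · rintro (⟨h1, h2⟩ | ⟨h1, h2⟩)
      · exact ⟨h1, by linarith⟩
      · exact ⟨⟨by linarith, by linarith⟩, h2⟩
  have hsub : Ioc s t ⊆ Icc a b := Ioc_subset_Icc_self.trans (Icc_subset_Icc hs.1 ht.2)
  simp only [hG]
  rw [hsplit, setIntegral_union _ measurableSet_Ioc ((hI k).mono_set inter_subset_left)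
    ((hI k).mono_set hsub)]
  · ring
  · exact Set.disjoint_left.2 fun x hx hx' => not_lt.2 hx.2 hx'.1

/-- A pointwise limit of functions whose increments are controlled by the integrals of a uniformly
integrable sequence is absolutely continuous. -/
theorem UniformlyIntegrableOn.absolutelyContinuousOnInterval {f g : ℕ → ℝ → ℝ} {G : ℝ → ℝ}
    {a b : ℝ} (h : UniformlyIntegrableOn f a b) (hab : a ≤ b) {C : ℝ} (hC : 0 < C)
    (hg : ∀ k, ∀ s ∈ Icc a b, ∀ t ∈ Icc a b, s ≤ t →
      |g k t - g k s| ≤ C * ∫ τ in Ioc s t, |f k τ|)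
    (hG : ∀ t ∈ Icc a b, Tendsto (fun k => g k t) atTop (𝓝 (G t))) :
    AbsolutelyContinuousOnInterval G a b := by
  have hI : ∀ k, IntegrableOn (fun t => |f k t|) (Icc a b) := fun k => (h.1 k).abs
  have hg' : ∀ k, ∀ s ∈ Icc a b, ∀ t ∈ Icc a b,
      dist (g k s) (g k t) ≤ C * ∫ τ in uIoc s t, |f k τ| := by
    intro k s hs t ht
    rcases le_total s t with hst | hst
    · rw [uIoc_of_le hst, dist_comm]
      exact hg k s hs t ht hst
    · rw [uIoc_of_ge hst]
      exact hg k t ht s hs hst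
  rw [absolutelyContinuousOnInterval_iff]
  intro ε hε
  -- Half of `ε`, since strict inequalities become weak in the limit.
  obtain ⟨δ, hδ, H⟩ := h.2 (ε / 2 / C) (by positivity)
  refine ⟨δ, hδ, ?_⟩
  rintro ⟨m, I⟩ hE hlen
  have hmem := hE.1
  have hsub := AbsolutelyContinuousOnInterval.biUnion_uIoc_subset_of_mem_disjWithin hE
  rw [uIcc_of_le hab] at hmem
  rw [uIoc_of_le hab] at hsub
  have hsub' := hsub.trans Ioc_subset_Icc_self
  have hvol : volume (⋃ i ∈ Finset.range m, uIoc (I i).1 (I i).2) < ENNReal.ofReal δ := by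
    refine (measure_biUnion_finset_le _ _).trans_lt ?_
    refine lt_of_eq_of_lt ?_ ((ENNReal.ofReal_lt_ofReal_iff hδ).2 hlen)
    rw [ENNReal.ofReal_sum_of_nonneg (fun _ _ => dist_nonneg)]
    refine Finset.sum_congr rfl fun i _ => ?_
    simp [uIoc, Real.dist_eq, max_sub_min_eq_abs']
  have hbound : ∀ k, ∑ i ∈ Finset.range m, dist (g k (I i).1) (g k (I i).2) ≤ ε / 2 := by
    intro k
    have h1 := H k _ hsub' (Finset.measurableSet_biUnion _ fun i _ => measurableSet_uIoc) hvol
    rw [integral_biUnion_finset _ (fun i _ => measurableSet_uIoc) hE.2 (fun i hi =>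
      (hI k).mono_set ((subset_biUnion_of_mem (u := fun i => uIoc (I i).1 (I i).2) hi).trans
        hsub')), lt_div_iff₀ hC, mul_comm, Finset.mul_sum] at h1
    exact (Finset.sum_le_sum fun i hi => hg' k _ (hmem i hi).1 _ (hmem i hi).2).trans h1.le
  have hle : ∑ i ∈ Finset.range m, dist (G (I i).1) (G (I i).2) ≤ ε / 2 :=
    le_of_tendsto' (tendsto_finsetSum _ fun i hi =>
      (hG _ (hmem i hi).1).dist (hG _ (hmem i hi).2)) hbound
  exact hle.trans_lt (half_lt_self hε)

/-! ### Differentiability almost everywhere and separating functions -/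

section SubRiemannian

variable {n : ℕ} {M : Type*} [TopologicalSpace M]
    [ChartedSpace (EuclideanSpace ℝ (Fin n)) M] [IsManifold (𝓡 n) ∞ M]

/-- An absolutely continuous curve is differentiable almost everywhere. -/
theorem IsACCurve.ae_mdifferentiableAt [T2Space M] [SecondCountableTopology M] {γ : ℝ → M} {a b : ℝ}
    (h : IsACCurve (n := n) γ a b) (hab : a ≤ b) :
    ∀ᵐ t ∂(volume.restrict (Icc a b)), MDifferentiableAt 𝓘(ℝ, ℝ) (𝓡 n) γ t := by
  have hW : ∀ p : M, {x : M | (∀ f : EuclideanSpace ℝ (Fin n) → ℝ,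
      cutoffCoord p f x = f (extChartAt (𝓡 n) p x)) ∧ x ∈ (extChartAt (𝓡 n) p).source} ∈ 𝓝 p :=
    fun p => (eventually_cutoffCoord_eq p).and (extChartAt_source_mem_nhds p)
  -- Countably many charts, with finitely many coordinates each, keep the exceptional set null.
  obtain ⟨s, hs, hcov⟩ :=
    TopologicalSpace.countable_cover_nhds (fun p => interior_mem_nhds.2 (hW p))
  have hdiff : ∀ᵐ t, ∀ p ∈ s, ∀ i : Fin n, t ∈ Icc a b →
      DifferentiableAt ℝ (cutoffCoord p (fun v : EuclideanSpace ℝ (Fin n) => v i) ∘ γ) t := by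
    rw [ae_ball_iff hs]
    intro p hp
    rw [ae_all_iff]
    intro i
    have := (h.2 _ (contMDiff_cutoffCoord p (f := fun v => v i)
      (EuclideanSpace.proj (𝕜 := ℝ) i).contDiff)
      (hasCompactSupport_cutoffCoord p _)).ae_differentiableAt
    rwa [uIcc_of_le hab] at this
  rw [← restrict_Ioo_eq_restrict_Icc]
  filter_upwards [ae_restrict_of_ae hdiff, ae_restrict_mem measurableSet_Ioo] with t ht htab
  have hγt : ContinuousAt γ t := h.1.continuousAt (Icc_mem_nhds htab.1 htab.2)
  obtain ⟨p, hp, hpt⟩ := mem_iUnion₂.1 (hcov ▸ mem_univ (γ t))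
  have hev := hγt.eventually (isOpen_interior.mem_nhds hpt)
  have hcoord : DifferentiableAt ℝ (fun τ => extChartAt (𝓡 n) p (γ τ)) t := by
    rw [differentiableAt_euclidean]
    intro i
    refine (ht p hp i (Ioo_subset_Icc_self htab)).congr_of_eventuallyEq ?_
    filter_upwards [hev] with τ hτ
    exact ((interior_subset hτ).1 fun v => v i).symm
  have hsrc := (interior_subset hpt).2
  have hsymm : MDifferentiableAt 𝓘(ℝ, EuclideanSpace ℝ (Fin n)) (𝓡 n) (extChartAt (𝓡 n) p).symm
      (extChartAt (𝓡 n) p (γ t)) :=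
    ((contMDiffOn_extChartAt_symm (n := ∞) p).contMDiffAt
      ((isOpen_extChartAt_target p).mem_nhds
        ((extChartAt (𝓡 n) p).map_source hsrc))).mdifferentiableAt (by simp)
  refine (hsymm.comp t hcoord.mdifferentiableAt).congr_of_eventuallyEq ?_
  filter_upwards [hev] with τ hτ
  exact ((extChartAt (𝓡 n) p).left_inv (interior_subset hτ).2).symm

/-- Smooth compactly supported functions separate a vector from a subspace not containing it. -/
theorem exists_differential_ne_zero [T2Space M] {x : M} {D : Submodule ℝ (TangentSpace (𝓡 n) x)}
    {v : TangentSpace (𝓡 n) x} (hv : v ∉ D) :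
    ∃ φ : M → ℝ, ContMDiff (𝓡 n) 𝓘(ℝ, ℝ) ∞ φ ∧ HasCompactSupport φ ∧
      (∀ w ∈ D, differential φ x w = 0) ∧ differential φ x v ≠ 0 := by
  obtain ⟨f, hfv, hf⟩ := Submodule.exists_le_ker_of_notMem hv
  obtain ⟨A, hA⟩ := isInvertible_mfderiv_extChartAt (I := 𝓡 n) (mem_extChartAt_source (I := 𝓡 n) x)
  -- The functional `f` read in the chart at `x`; the cut-off of this linear function has
  -- differential `f` at `x`.
  let L : EuclideanSpace ℝ (Fin n) →ₗ[ℝ] ℝ := f ∘ₗ (A.symm : _ ≃L[ℝ] _).toLinearMap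
  let L' : EuclideanSpace ℝ (Fin n) →L[ℝ] ℝ := LinearMap.toContinuousLinearMap L
  have hd : ∀ w, differential (cutoffCoord x L') x w = f w := by
    intro w
    have h1 : cutoffCoord x L' =ᶠ[𝓝 x] L' ∘ extChartAt (𝓡 n) x := by
      filter_upwards [eventually_cutoffCoord_eq (n := n) x] with y hy
      exact hy _
    have h2 : mfderiv (𝓡 n) 𝓘(ℝ, ℝ) (L' ∘ extChartAt (𝓡 n) x) x =
        (mfderiv 𝓘(ℝ, EuclideanSpace ℝ (Fin n)) 𝓘(ℝ, ℝ) L' (extChartAt (𝓡 n) x x)).comp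
          (mfderiv (𝓡 n) 𝓘(ℝ, EuclideanSpace ℝ (Fin n)) (extChartAt (𝓡 n) x) x) :=
      mfderiv_comp x L'.differentiableAt.mdifferentiableAt
        (mdifferentiableAt_extChartAt (mem_chart_source _ x))
    rw [mfderiv_eq_fderiv, L'.fderiv, ← hA] at h2
    rw [differential, h1.mfderiv_eq, h2]
    change f (A.symm (A w)) = f w
    rw [A.symm_apply_apply]
  refine ⟨cutoffCoord x L', contMDiff_cutoffCoord x L'.contDiff, hasCompactSupport_cutoffCoord x _,
    fun w hw => (hd w).trans (hf hw), ?_⟩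
  rw [hd]
  exact hfv

/-! ### The limit curve -/

namespace SubRiemannianStructure

variable {S : SubRiemannianStructure n M}

theorem speed_nonneg (S : SubRiemannianStructure n M) (η : ℝ → M) (t : ℝ) : 0 ≤ S.speed η t :=
  S.zero_le_norm _

theorem IsHorizontal.abs_sub_le_integral {η : ℝ → M} {a b s t : ℝ} (h : S.IsHorizontal η a b)
    (hint : IntegrableOn (S.speed η) (Icc a b)) (hs : a ≤ s) (hst : s ≤ t) (ht : t ≤ b)
    {φ : M → ℝ} (hφ : ContMDiff (𝓡 n) 𝓘(ℝ, ℝ) ∞ φ) (hc : HasCompactSupport φ) {C : ℝ} (hC : 0 ≤ C)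
    (hle : ∀ τ ∈ Icc s t, ∀ v ∈ S.D (η τ), |differential φ (η τ) v| ≤ C * S.norm v) :
    |φ (η t) - φ (η s)| ≤ C * ∫ τ in Ioc s t, |S.speed η τ| := by
  have h1 := (h.mono hs hst ht).abs_sub_le hst hφ hc hC hle
  have h0 : 0 ≤ ∫ τ in Icc s t, S.speed η τ := integral_nonneg fun τ => S.speed_nonneg η τ
  rw [length, ← ofReal_integral_eq_lintegral_ofReal (hint.mono_set (Icc_subset_Icc hs ht))
    (Eventually.of_forall fun τ => S.speed_nonneg η τ), ← ENNReal.ofReal_mul hC,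
    ENNReal.ofReal_le_ofReal_iff (mul_nonneg hC h0), integral_Icc_eq_integral_Ioc] at h1
  simpa only [abs_of_nonneg (S.speed_nonneg η _)] using h1

theorem CCTendstoUniformlyOn.isACCurve [T2Space M] {γs : ℕ → ℝ → M} {γ : ℝ → M} {a b : ℝ}
    (hlim : S.CCTendstoUniformlyOn γs γ a b) (hab : a ≤ b)
    (hγs : ∀ k, S.IsHorizontal (γs k) a b)
    (hui : UniformlyIntegrableOn (fun k => S.speed (γs k)) a b) : IsACCurve (n := n) γ a b := by
  refine ⟨hlim.continuousOn fun k => (hγs k).1.1, fun φ hφ hc => ?_⟩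
  obtain ⟨C, hC, hle⟩ := S.exists_abs_differential_le hφ hc
  exact hui.absolutelyContinuousOnInterval hab hC
    (fun k s hs t ht hst => (hγs k).abs_sub_le_integral (hui.1 k) hs.1 hst ht.2 hφ hc hC.le
      fun τ _ => hle _) fun t ht => (hlim.comp hφ hc).tendsto_at ht

/-- If the differential of `φ` vanishes on the horizontal space at `γ t`, then the increments of
`φ ∘ γ` at `t` are negligible with respect to those of the limit of the primitives of the speeds. -/
theorem CCTendstoUniformlyOn.isLittleO [T2Space M] {γs : ℕ → ℝ → M} {γ : ℝ → M} {a b : ℝ}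
    (hlim : S.CCTendstoUniformlyOn γs γ a b) (hγs : ∀ k, S.IsHorizontal (γs k) a b)
    (hui : UniformlyIntegrableOn (fun k => S.speed (γs k)) a b) {𝒰 : Ultrafilter ℕ}
    (h𝒰 : (𝒰 : Filter ℕ) ≤ atTop) {F : ℝ → ℝ}
    (hF : ∀ s ∈ Icc a b, ∀ t ∈ Icc a b, s ≤ t →
        Tendsto (fun k => ∫ τ in Ioc s t, |S.speed (γs k) τ|) 𝒰 (𝓝 (F t - F s)))
    {φ : M → ℝ} (hφ : ContMDiff (𝓡 n) 𝓘(ℝ, ℝ) ∞ φ) (hc : HasCompactSupport φ) {t : ℝ}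
    (ht : t ∈ Ioo a b) (hD : ∀ v ∈ S.D (γ t), differential φ (γ t) v = 0) :
    (fun s => φ (γ s) - φ (γ t)) =o[𝓝 t] fun s => F s - F t := by
  rw [Asymptotics.isLittleO_iff]
  intro ε hε
  obtain ⟨ψ, -, hψ⟩ := (SmoothBumpFunction.nhds_basis_tsupport (I := 𝓡 n) (γ t)).mem_iff.1
    (S.eventually_abs_differential_le hφ hD hε)
  have hγt : ContinuousAt γ t := (hlim.continuousOn fun k => (hγs k).1.1).continuousAt
    (Icc_mem_nhds ht.1 ht.2)
  -- With `ψ ∘ γs k` uniformly within `1 / 2` of `ψ ∘ γ`, this forces `ψ (γs k τ) ≠ 0`, so `γs k`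
  -- stays in the region of the `ε`-bound for all large `k`.
  have hev : ∀ᶠ s in 𝓝 t, s ∈ Ioo a b ∧ 1 / 2 < ψ (γ s) := by
    refine Eventually.and (isOpen_Ioo.mem_nhds ht) ?_
    refine (ψ.continuous.continuousAt.comp hγt).eventually (lt_mem_nhds ?_)
    simp only [Function.comp_apply, ψ.eq_one]
    norm_num
  obtain ⟨r, hr, hball⟩ := Metric.eventually_nhds_iff_ball.1 hev
  have hclose := (Metric.tendstoUniformlyOn_iff.1 (hlim.comp ψ.contMDiff ψ.hasCompactSupport))
    (1 / 2) (by norm_num)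
  have key : ∀ u ∈ Metric.ball t r, ∀ w ∈ Metric.ball t r, u ≤ w →
      |φ (γ w) - φ (γ u)| ≤ ε * (F w - F u) := by
    intro u hu w hw huw
    have hu' := Ioo_subset_Icc_self (hball u hu).1
    have hw' := Ioo_subset_Icc_self (hball w hw).1
    have hconv := hlim.comp hφ hc
    refine le_of_tendsto_of_tendsto ((((hconv.tendsto_at hw').sub (hconv.tendsto_at hu')).abs).mono_left
      h𝒰) ((hF u hu' w hw' huw).const_mul ε) (h𝒰 ?_)
    filter_upwards [hclose] with k hk
    refine (hγs k).abs_sub_le_integral (hui.1 k) hu'.1 huw hw'.2 hφ hc hε.le fun τ hτ => ?_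
    have hτb : τ ∈ Metric.ball t r := (convex_ball t r).ordConnected.out hu hw hτ
    have h1 := hk τ (Ioo_subset_Icc_self (hball τ hτb).1)
    have h2 := (hball τ hτb).2
    refine hψ (subset_tsupport _ (Function.mem_support.2 fun h0 => ?_))
    simp only [Function.comp_apply, h0, dist_zero_right, Real.norm_eq_abs] at h1
    linarith [le_abs_self (ψ (γ τ))]
  filter_upwards [Metric.ball_mem_nhds t hr] with s hs
  rw [Real.norm_eq_abs, Real.norm_eq_abs]
  rcases le_total s t with hst | hst
  · rw [abs_sub_comm, abs_sub_comm (F s)]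
    exact (key s hs t (Metric.mem_ball_self hr) hst).trans
      (mul_le_mul_of_nonneg_left (le_abs_self _) hε.le)
  · exact (key t (Metric.mem_ball_self hr) s hs hst).trans
      (mul_le_mul_of_nonneg_left (le_abs_self _) hε.le)

end SubRiemannianStructure
end SubRiemannian

theorem mainTheorem2 {n : ℕ} {M : Type*} [TopologicalSpace M] [T2Space M]
    [SecondCountableTopology M] [ChartedSpace (EuclideanSpace ℝ (Fin n)) M]
    [IsManifold (𝓡 n) ∞ M]
    (S : SubRiemannianStructure n M) (hS : S.BracketGenerating)
    (a b : ℝ) (hab : a ≤ b) (γs : ℕ → ℝ → M) (γ : ℝ → M)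
    (hγs : ∀ k, S.IsHorizontal (γs k) a b)
    (hlim : S.CCTendstoUniformlyOn γs γ a b)
    (hui : UniformlyIntegrableOn (fun k => S.speed (γs k)) a b) :
    S.IsHorizontal γ a b := by
  have hac := hlim.isACCurve hab hγs hui
  refine ⟨hac, ?_⟩
  obtain ⟨𝒰, F, h𝒰, hFm, hF⟩ := hui.exists_monotone
  have hmd := hac.ae_mdifferentiableAt hab
  rw [← restrict_Ioo_eq_restrict_Icc] at hmd ⊢
  filter_upwards [hmd, ae_restrict_of_ae hFm.ae_differentiableAt,
    ae_restrict_mem measurableSet_Ioo] with t hγt hFt ht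
  refine ⟨hγt, ?_⟩
  by_contra hv
  obtain ⟨φ, hφ, hc, hD, hne⟩ := exists_differential_ne_zero hv
  -- It remains to see that `φ ∘ γ` has derivative `0` at `t`.
  refine hne ((hγt.hasDerivAt_comp (hφ.mdifferentiable (by simp) _)).unique ?_)
  rw [hasDerivAt_iff_isLittleO]
  simpa using (hlim.isLittleO hγs hui h𝒰 hF hφ hc ht hD).trans_isBigO hFt.isBigO_sub
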